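/- Let $n,N\ge 1$ be integers, let $\xi_1,\dots,\xi_N\in[-1,1]$ and $\lambda_1,\dots,\lambda_N\ge 0$, and put $T(f)=\sum_{i=1}^N\lambda_i f(\xi_i)$ for $f:[-1,1]\to\mathbb R$. Let $\Pi_k$ be the space of real polynomials of degree at most $k$; $T$ is called exact on $\Pi_k$ if $T(p)=\int_{-1}^1 p(x)\,dx$ for all $p\in\Pi_k$. Define divided differences by $[x_1;f]=f(x_1)$ and $[x_1,\dots,x_{k+1};f]=\dfrac{[x_2,\dots,x_{k+1};f]-[x_1,\dots,x_k;f]}{x_{k+1}-x_1}$. A function $f:[-1,1]\to\mathbb R$ is called $m$-convex if $[x_1,\dots,x_{m+2};f]\ge 0$ for all distinct $x_1,\dots,x_{m+2}\in[-1,1]$. Let $P_m(x)=\frac{1}{2^m m!}\frac{d^m}{dx^m}(x^2-1)^m$ be the Legendre polynomials, and let - $G_m(f)=\sum_{x:\,P_m(x)=0}\dfrac{2(1-x^2)}{(m+1)^2P_{m+1}(x)^2}\,f(x)$ for $m\ge 1$ (Gauss–Legendre), - $\mathrm{Lob}_m(f)=\dfrac{2}{m(m-1)}\bigl(f(-1)+f(1)\bigr)+\sum_{x:\,P_{m-1}'(x)=0}\dfrac{2}{m(m-1)P_{m-1}(x)^2}\,f(x)$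 for $m\ge 2$ (Lobatto; for $m=2$ the sum is empty), - $\mathrm{Rad}^l_m(f)=\dfrac{2}{m^2}f(-1)+\sum_{x:\,Q_{m-1}(x)=0}\dfrac{1}{(1-x)P_{m-1}'(x)^2}\,f(x)$ for $m\ge 2$, where $Q_{m-1}(x)=\dfrac{P_{m-1}(x)+P_m(x)}{x+1}$ (left Radau), - $\mathrm{Rad}^r_m(f)=\mathrm{Rad}^l_m\bigl(f(-\,\cdot)\bigr)$ for $m\ge 2$ (right Radau). All roots occurring here are real, simple and lie in $(-1,1)$. Then: (i) If $T$ is exact on $\Pi_{2n-1}$, then $G_n(f)\le T(f)\le \mathrm{Lob}_{n+1}(f)$ for every $(2n-1)$-convex function $f:[-1,1]\to\mathbb R$. (ii) If $T$ is exact on $\Pi_{2n}$, then $\mathrm{Rad}^l_{n+1}(f)\le T(f)\le \mathrm{Rad}^r_{n+1}(f)$ for every $2n$-convex function $f:[-1,1]\to\mathbb R$. -/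

import Mathlib

open Polynomial

noncomputable section

namespace ApproxIntegration

/-- The divided difference `[x 0, …, x k; f]`, by the usual recursion. -/
def divDiff (f : ℝ → ℝ) : (k : ℕ) → (Fin (k + 1) → ℝ) → ℝ
  | 0, x => f (x 0)
  | k + 1, x =>
      (divDiff f k (fun i => x i.succ) - divDiff f k (fun i => x i.castSucc)) /
        (x (Fin.last (k + 1)) - x 0)

/-- `f` is `m`-convex on `I` (convexity of order `m` in the sense of Popoviciu, so that ordinary
convexity is `1`-convexity): all divided differences at `m + 2` distinct points of `I` are
nonnegative. Only the values of `f` on `I` matter. -/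
def HigherConvexOn (m : ℕ) (I : Set ℝ) (f : ℝ → ℝ) : Prop :=
  ∀ x : Fin (m + 2) → ℝ, Function.Injective x → (∀ i, x i ∈ I) → 0 ≤ divDiff f (m + 1) x

/-- The functional `T` is exact on `Π_k`: it agrees with the integral over `[-1, 1]` on all real
polynomials of degree at most `k`. -/
def IsExactOn (T : (ℝ → ℝ) → ℝ) (k : ℕ) : Prop :=
  ∀ p : ℝ[X], p.natDegree ≤ k → T (fun x => p.eval x) = ∫ x in (-1 : ℝ)..1, p.eval x

/-- The quadrature with coefficients `c i` and nodes `ξ i`. -/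
def quadrature {N : ℕ} (c ξ : Fin N → ℝ) (f : ℝ → ℝ) : ℝ :=
  ∑ i, c i * f (ξ i)

/-- The `n`-th Legendre polynomial, by Rodrigues' formula. -/
def legendre (n : ℕ) : ℝ[X] :=
  C (((2 : ℝ) ^ n * (n.factorial : ℝ))⁻¹) * derivative^[n] ((X ^ 2 - 1) ^ n)

/-- The `n`-point Gauss–Legendre quadrature on `[-1, 1]` (`n ≥ 1`). The nodes are the roots of
the Legendre polynomial of degree `n`. -/
def gauss (n : ℕ) (f : ℝ → ℝ) : ℝ :=
  ∑ x ∈ (legendre n).roots.toFinset,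
    2 * (1 - x ^ 2) / (((n : ℝ) + 1) ^ 2 * (legendre (n + 1)).eval x ^ 2) * f x

/-- The `n`-point Lobatto quadrature on `[-1, 1]` (`n ≥ 2`). The interior nodes are the roots of
the derivative of the Legendre polynomial of degree `n - 1`; for `n = 2` there are none, and the
two remaining weights are `1`. -/
def lobatto (n : ℕ) (f : ℝ → ℝ) : ℝ :=
  2 / ((n : ℝ) * ((n : ℝ) - 1)) * f (-1) + 2 / ((n : ℝ) * ((n : ℝ) - 1)) * f 1 +
    ∑ x ∈ (derivative (legendre (n - 1))).roots.toFinset,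
      2 / ((n : ℝ) * ((n : ℝ) - 1) * (legendre (n - 1)).eval x ^ 2) * f x

/-- The `n`-point left Radau quadrature on `[-1, 1]` (`n ≥ 2`). The nodes other than `-1` are the
roots of `(P_{n-1} + P_n) / (X + 1)`, which is an exact quotient of polynomials. -/
def radauLeft (n : ℕ) (f : ℝ → ℝ) : ℝ :=
  2 / (n : ℝ) ^ 2 * f (-1) +
    ∑ x ∈ ((legendre (n - 1) + legendre n) / (X + 1)).roots.toFinset,
      1 / ((1 - x) * (derivative (legendre (n - 1))).eval x ^ 2) * f x

/-- The `n`-point right Radau quadrature on `[-1, 1]` (`n ≥ 2`), the mirror image of the left. -/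
def radauRight (n : ℕ) (f : ℝ → ℝ) : ℝ :=
  radauLeft n (fun x => f (-x))

end ApproxIntegration

end

open Polynomial

noncomputable section

namespace ApproxIntegration

/-! Each explicit rule `L` is exact on Π_m and has nodes `E ∪ R`, where `E` ⊆ {-1, 1}, `R` is
interior and |E| + 2|R| = m + 1. Suppose p ∈ Π_m interpolates f simply at `E` and doubly at `R`.
Then m-convexity gives f - p the sign of ∏_{e ∈ E} (x - e), which is constant on [-1, 1]. Since L(f)
= L(p) = ∫p = T(p), the difference T(f) - L(f) = ∑ c_i (f - p)(ξ_i) has that sign as well.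

No differentiability of f is assumed, so a double node a is replaced by the pair a, a + h. Only the
finitely many points ξ_i matter, and h is taken so small that none of them separates the pair. This
is `HigherConvexOn.exists_comparison`; `quadrature_comparison` draws the inequality.

It remains to show that the four rules, with their stated weights, are exact. Rodrigues' formula
yields real zeros by Rolle and orthogonality by parts. Orthogonality makes the zeros simple and
interior (`roots_of_orthogonal`) and makes some choice of weights exact (`exists_weights`). Those
weights are then identified by test polynomials that vanish at all nodes but one, integrated by
parts. -/

/-! ### Divided differences and interpolation -/

theorem eq_of_natDegree_le_of_eval_eq {k : ℕ} {p q : ℝ[X]} (hp : p.natDegree ≤ k)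
    (hq : q.natDegree ≤ k) {x : Fin (k + 1) → ℝ} (hx : Function.Injective x)
    (h : ∀ i, p.eval (x i) = q.eval (x i)) : p = q := by
  refine Polynomial.eq_of_degrees_lt_of_eval_index_eq (Finset.univ : Finset (Fin (k + 1)))
    hx.injOn ?_ ?_ (fun i _ => h i)
  · rw [Finset.card_fin]
    exact lt_of_le_of_lt (degree_le_of_natDegree_le hp) (by exact_mod_cast Nat.lt_succ_self k)
  · rw [Finset.card_fin]
    exact lt_of_le_of_lt (degree_le_of_natDegree_le hq) (by exact_mod_cast Nat.lt_succ_self k)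

theorem exists_interpolant (S : Finset ℝ) {k : ℕ} (hS : S.card ≤ k + 1) (f : ℝ → ℝ) :
    ∃ p : ℝ[X], p.natDegree ≤ k ∧ ∀ y ∈ S, p.eval y = f y := by
  refine ⟨Lagrange.interpolate S id f, ?_, fun y hy => ?_⟩
  · rw [natDegree_le_iff_coeff_eq_zero]
    intro j hj
    have h := Lagrange.degree_interpolate_lt (s := S) (v := id) f Function.injective_id.injOn
    exact coeff_eq_zero_of_degree_lt (h.trans_le (by exact_mod_cast hS.trans hj))
  · exact Lagrange.eval_interpolate_at_node (v := id) f Function.injective_id.injOn hy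

/-- The divided difference is the leading coefficient of the interpolation polynomial. -/
theorem coeff_interpolant_eq_divDiff (f : ℝ → ℝ) (k : ℕ) (x : Fin (k + 1) → ℝ)
    (hx : Function.Injective x) (p : ℝ[X]) (hp : p.natDegree ≤ k)
    (hpf : ∀ i, p.eval (x i) = f (x i)) : p.coeff k = divDiff f k x := by
  induction k generalizing p with
  | zero =>
    have h := hpf 0
    rw [eq_C_of_natDegree_le_zero hp, eval_C] at h
    simpa [divDiff] using h
  | succ k ih =>
    have hs : Function.Injective (fun i : Fin (k + 1) => x i.succ) :=
      hx.comp (Fin.succ_injective _)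
    have hc : Function.Injective (fun i : Fin (k + 1) => x i.castSucc) :=
      hx.comp (Fin.castSucc_injective _)
    obtain ⟨q, hq, hqf⟩ := exists_interpolant (Finset.univ.image fun i : Fin (k + 1) => x i.succ)
      (k := k) (Finset.card_image_le.trans (by simp)) f
    obtain ⟨r, hr, hrf⟩ := exists_interpolant
      (Finset.univ.image fun i : Fin (k + 1) => x i.castSucc)
      (k := k) (Finset.card_image_le.trans (by simp)) f
    replace hqf : ∀ i : Fin (k + 1), q.eval (x i.succ) = f (x i.succ) := fun i =>
      hqf _ (Finset.mem_image_of_mem _ (Finset.mem_univ i))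
    replace hrf : ∀ i : Fin (k + 1), r.eval (x i.castSucc) = f (x i.castSucc) := fun i =>
      hrf _ (Finset.mem_image_of_mem _ (Finset.mem_univ i))
    have hne : x (Fin.last (k + 1)) - x 0 ≠ 0 := by
      rw [sub_ne_zero]
      exact fun h => absurd (hx h) (Fin.last_pos).ne'
    -- Aitken–Neville: the interpolants on the last and on the first k + 1 nodes combine into the
    -- full one.
    have key : C (x (Fin.last (k + 1)) - x 0) * p =
        (X - C (x 0)) * q - (X - C (x (Fin.last (k + 1)))) * r := by
      refine eq_of_natDegree_le_of_eval_eq (k := k + 1) ?_ ?_ hx ?_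
      · exact (natDegree_C_mul_le _ _).trans hp
      · refine (natDegree_sub_le _ _).trans (max_le ?_ ?_)
        · refine natDegree_mul_le.trans ?_
          rw [natDegree_X_sub_C]; omega
        · refine natDegree_mul_le.trans ?_
          rw [natDegree_X_sub_C]; omega
      · intro i
        simp only [eval_mul, eval_sub, eval_C, eval_X, hpf]
        have h1 : (x i - x 0) * q.eval (x i) = (x i - x 0) * f (x i) := by
          refine Fin.cases ?_ (fun j => ?_) i
          · simp
          · rw [hqf]
        have h2 : (x i - x (Fin.last (k + 1))) * r.eval (x i) =
            (x i - x (Fin.last (k + 1))) * f (x i) := by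
          refine Fin.lastCases ?_ (fun j => ?_) i
          · simp
          · rw [hrf]
        rw [h1, h2]; ring
    have hcoeff := congrArg (fun t => coeff t (k + 1)) key
    simp only [coeff_C_mul, coeff_sub, sub_mul, coeff_X_mul,
      coeff_eq_zero_of_natDegree_lt (Nat.lt_succ_of_le hq),
      coeff_eq_zero_of_natDegree_lt (Nat.lt_succ_of_le hr), mul_zero, sub_zero] at hcoeff
    rw [divDiff, ← ih _ hs q hq hqf, ← ih _ hc r hr hrf, eq_div_iff hne, ← hcoeff]
    ring

/-- Newton's remainder: adding c times the nodal polynomial to p makes it interpolate at x too, so c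
is a divided difference of order m + 1, hence nonnegative. -/
theorem HigherConvexOn.interpolation_error {m : ℕ} {I : Set ℝ} {f : ℝ → ℝ}
    (hf : HigherConvexOn m I f) {S : Finset ℝ} (hS : S.card = m + 1) (hSI : ∀ y ∈ S, y ∈ I)
    {p : ℝ[X]} (hp : p.natDegree ≤ m) (hpf : ∀ y ∈ S, p.eval y = f y) {x : ℝ} (hx : x ∈ I) :
    0 ≤ (f x - p.eval x) * ∏ y ∈ S, (x - y) := by
  by_cases hxS : x ∈ S
  · simp [hpf x hxS]
  set M : ℝ[X] := ∏ y ∈ S, (X - C y) with hM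
  have hMx : M.eval x = ∏ y ∈ S, (x - y) := by simp [hM, eval_prod]
  have hM0 : M.eval x ≠ 0 := by
    rw [hMx, Finset.prod_ne_zero_iff]
    rintro y hy h
    exact hxS (by rwa [sub_eq_zero.1 h])
  have hMm : M.Monic := monic_prod_of_monic _ _ fun y _ => monic_X_sub_C y
  have hMd : M.natDegree = m + 1 := by
    rw [hM, natDegree_finsetProd_X_sub_C_eq_card, hS]
  set c : ℝ := (f x - p.eval x) / M.eval x with hc
  have hcard : (insert x S).card = m + 2 := by rw [Finset.card_insert_of_notMem hxS, hS]
  set e := (insert x S).orderEmbOfFin hcard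
  have heS : ∀ i, e i ∈ insert x S := fun i => Finset.orderEmbOfFin_mem _ hcard i
  have hcd : (p + C c * M).coeff (m + 1) = divDiff f (m + 1) e := by
    refine coeff_interpolant_eq_divDiff f (m + 1) e e.injective _ ?_ ?_
    · refine (natDegree_add_le _ _).trans (max_le (by omega) ?_)
      exact (natDegree_C_mul_le _ _).trans hMd.le
    · intro i
      rcases Finset.mem_insert.1 (heS i) with h | h
      · rw [h, eval_add, eval_mul, eval_C, hc, div_mul_cancel₀ _ hM0]; ring
      · have : M.eval (e i) = 0 := by
          rw [hM, eval_prod]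
          exact Finset.prod_eq_zero h (by simp)
        rw [eval_add, eval_mul, this, mul_zero, add_zero, hpf _ h]
  have hc0 : 0 ≤ c := by
    have : (p + C c * M).coeff (m + 1) = c := by
      rw [coeff_add, coeff_eq_zero_of_natDegree_lt (Nat.lt_succ_of_le hp), coeff_C_mul, ← hMd,
        hMm.coeff_natDegree]
      ring
    rw [← this, hcd]
    refine hf e e.injective fun i => ?_
    rcases Finset.mem_insert.1 (heS i) with h | h
    · rw [h]; exact hx
    · exact hSI _ h
  rw [← hMx, show f x - p.eval x = c * M.eval x by rw [hc, div_mul_cancel₀ _ hM0], mul_assoc]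
  exact mul_nonneg hc0 (mul_self_nonneg _)

/-! ### One-sided comparison without derivatives -/

theorem exists_pos_add_lt (R F : Finset ℝ) :
    ∃ h : ℝ, 0 < h ∧ ∀ a ∈ R, ∀ b ∈ F, a < b → a + h < b := by
  have : ∀ᶠ h in nhdsWithin (0 : ℝ) (Set.Ioi 0), ∀ a ∈ R, ∀ b ∈ F, a < b → a + h < b := by
    rw [Finset.eventually_all]
    intro a _
    rw [Finset.eventually_all]
    intro b _
    by_cases hab : a < b
    · filter_upwards [Ioo_mem_nhdsGT (sub_pos.2 hab)] with h hh _
      linarith [hh.2]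
    · exact Filter.Eventually.of_forall fun _ h => absurd h hab
  obtain ⟨h, h1, h2⟩ := (this.and self_mem_nhdsWithin).exists
  exact ⟨h, h2, h1⟩

/-- A one-sided polynomial comparison: `f` is interpolated on `E ∪ R`, and its position relative to
the interpolant at the points of `Ξ` is governed by the simple nodes `E` only. -/
theorem HigherConvexOn.exists_comparison {m : ℕ} {f : ℝ → ℝ}
    (hf : HigherConvexOn m (Set.Icc (-1) 1) f) {E R : Finset ℝ} (hER : Disjoint E R)
    (hE : ∀ e ∈ E, e ∈ Set.Icc (-1 : ℝ) 1) (hR : ∀ a ∈ R, a ∈ Set.Ioo (-1 : ℝ) 1)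
    (hcard : E.card + 2 * R.card = m + 1) (Ξ : Finset ℝ)
    (hΞ : ∀ x ∈ Ξ, x ∈ Set.Icc (-1 : ℝ) 1) :
    ∃ p : ℝ[X], p.natDegree ≤ m ∧ (∀ y ∈ E ∪ R, p.eval y = f y) ∧
      ∀ x ∈ Ξ, 0 ≤ (f x - p.eval x) * ∏ e ∈ E, (x - e) := by
  obtain ⟨h, h0, hh⟩ := exists_pos_add_lt R (insert 1 (E ∪ R ∪ Ξ))
  have hnot : ∀ b ∈ E ∪ R, ∀ a ∈ R, a + h ≠ b := by
    intro b hb a ha hab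
    have := hh a ha b (Finset.mem_insert_of_mem (Finset.mem_union_left _ hb)) (by linarith)
    linarith
  set R' := R.image (· + h) with hR'
  have hinj : Function.Injective (fun a : ℝ => a + h) := add_left_injective h
  have hdisj : Disjoint (E ∪ R) R' := by
    rw [Finset.disjoint_left]
    intro b hb hb'
    obtain ⟨a, ha, hab⟩ := Finset.mem_image.1 hb'
    exact hnot b hb a ha hab
  have hS : (E ∪ R ∪ R').card = m + 1 := by
    rw [Finset.card_union_of_disjoint hdisj, Finset.card_union_of_disjoint hER, hR',
      Finset.card_image_of_injective _ hinj]
    omega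
  have hSI : ∀ y ∈ E ∪ R ∪ R', y ∈ Set.Icc (-1 : ℝ) 1 := by
    intro y hy
    rcases Finset.mem_union.1 hy with hy | hy
    · rcases Finset.mem_union.1 hy with hy | hy
      · exact hE y hy
      · exact Set.Ioo_subset_Icc_self (hR y hy)
    · obtain ⟨a, ha, rfl⟩ := Finset.mem_image.1 hy
      have := hh a ha 1 (Finset.mem_insert_self _ _) (hR a ha).2
      exact ⟨by linarith [(hR a ha).1], this.le⟩
  obtain ⟨p, hp, hpf⟩ := exists_interpolant (E ∪ R ∪ R') hS.le f
  refine ⟨p, hp, fun y hy => hpf y (Finset.mem_union_left _ hy), fun x hx => ?_⟩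
  have herr := hf.interpolation_error hS hSI hp hpf (hΞ x hx)
  rw [Finset.prod_union hdisj, Finset.prod_union hER, hR', Finset.prod_image hinj.injOn,
    mul_assoc, ← Finset.prod_mul_distrib, ← mul_assoc] at herr
  by_cases hxS : x ∈ E ∪ R ∪ R'
  · rw [hpf x hxS]; simp
  -- The choice of h puts no point of `Ξ` strictly between a and a + h, so each pair acts like a
  -- double node.
  have hpos : 0 < ∏ a ∈ R, (x - a) * (x - (a + h)) := by
    refine Finset.prod_pos fun a ha => ?_
    have hne : x ≠ a := by
      rintro rfl
      exact hxS (by simp [ha])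
    rcases lt_or_gt_of_ne hne with hlt | hgt
    · exact mul_pos_of_neg_of_neg (by linarith) (by linarith)
    · have := hh a ha x (by simp [hx]) hgt
      exact mul_pos (by linarith) (by linarith)
  exact nonneg_of_mul_nonneg_left herr hpos

theorem quadrature_comparison {m N : ℕ} {ξ c : Fin N → ℝ}
    (hξ : ∀ i, ξ i ∈ Set.Icc (-1 : ℝ) 1) (hc : ∀ i, 0 ≤ c i)
    (hT : IsExactOn (quadrature c ξ) m) {f : ℝ → ℝ}
    (hf : HigherConvexOn m (Set.Icc (-1) 1) f) {E R : Finset ℝ} (hER : Disjoint E R)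
    (hE : ∀ e ∈ E, e ∈ Set.Icc (-1 : ℝ) 1) (hR : ∀ a ∈ R, a ∈ Set.Ioo (-1 : ℝ) 1)
    (hcard : E.card + 2 * R.card = m + 1) {L : (ℝ → ℝ) → ℝ} (hL : IsExactOn L m)
    (hLc : ∀ f g : ℝ → ℝ, (∀ y ∈ E ∪ R, f y = g y) → L f = L g) {σ : ℝ}
    (hσ : ∀ x ∈ Set.Icc (-1 : ℝ) 1, 0 ≤ σ * ∏ e ∈ E, (x - e))
    (hσ' : ∀ x ∈ Set.Icc (-1 : ℝ) 1, x ∉ E → ∏ e ∈ E, (x - e) ≠ 0) :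
    0 ≤ σ * (quadrature c ξ f - L f) := by
  obtain ⟨p, hp, hpf, hpx⟩ := hf.exists_comparison hER hE hR hcard (Finset.univ.image ξ)
    (by simpa using hξ)
  have h1 : L f = quadrature c ξ fun x => p.eval x := by
    rw [hT p hp, ← hL p hp]
    exact hLc _ _ fun y hy => (hpf y hy).symm
  rw [h1, quadrature, quadrature, ← Finset.sum_sub_distrib, Finset.mul_sum]
  refine Finset.sum_nonneg fun i _ => ?_
  have h2 := hpx (ξ i) (by simp)
  have h3 := hσ _ (hξ i)
  rw [← mul_sub, mul_left_comm]
  refine mul_nonneg (hc i) ?_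
  by_cases hi : ξ i ∈ E
  · rw [hpf _ (Finset.mem_union_left _ hi)]; simp
  have h4 := hσ' _ (hξ i) hi
  -- Multiplying the two sign conditions squares the nodal product, which can then be cancelled off
  -- `E`.
  have h5 : 0 ≤ (σ * (f (ξ i) - p.eval (ξ i))) * (∏ e ∈ E, (ξ i - e)) ^ 2 := by
    have := mul_nonneg h2 h3
    nlinarith
  exact nonneg_of_mul_nonneg_left h5 (by positivity)

/-! ### Integration of polynomials and orthogonality -/

/-- The integral over `[-1, 1]` as a linear functional on polynomials. -/
def polyIntegral : ℝ[X] →ₗ[ℝ] ℝ where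
  toFun p := ∫ x in (-1 : ℝ)..1, p.eval x
  map_add' p q := by
    simp only [eval_add]
    exact intervalIntegral.integral_add (p.continuous.intervalIntegrable _ _)
      (q.continuous.intervalIntegrable _ _)
  map_smul' a p := by
    simp only [eval_smul, smul_eq_mul, RingHom.id_apply]
    exact intervalIntegral.integral_const_mul _ _

theorem polyIntegral_apply (p : ℝ[X]) : polyIntegral p = ∫ x in (-1 : ℝ)..1, p.eval x := rfl

theorem polyIntegral_C_mul (a : ℝ) (p : ℝ[X]) : polyIntegral (C a * p) = a * polyIntegral p := by
  rw [← smul_eq_C_mul, map_smul, smul_eq_mul]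

theorem polyIntegral_derivative (p : ℝ[X]) :
    polyIntegral (derivative p) = p.eval 1 - p.eval (-1) :=
  intervalIntegral.integral_eq_sub_of_hasDerivAt (fun x _ => p.hasDerivAt x)
    (p.derivative.continuous.intervalIntegrable _ _)

theorem polyIntegral_derivative_mul (p q : ℝ[X]) :
    polyIntegral (derivative p * q) =
      p.eval 1 * q.eval 1 - p.eval (-1) * q.eval (-1) - polyIntegral (p * derivative q) := by
  have h := polyIntegral_derivative (p * q)
  rw [derivative_mul, map_add, eval_mul, eval_mul] at h
  linarith

theorem polyIntegral_pos {p : ℝ[X]} (hp : p ≠ 0)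
    (h : ∀ x ∈ Set.Icc (-1 : ℝ) 1, 0 ≤ p.eval x) : 0 < polyIntegral p := by
  refine intervalIntegral.integral_pos (by norm_num) p.continuous.continuousOn
    (fun x hx => h x ⟨hx.1.le, hx.2⟩) ?_
  obtain ⟨c, hc, hcr⟩ := (Set.Icc_infinite (show (-1 : ℝ) < 1 by norm_num)).exists_notMem_finset
    p.roots.toFinset
  refine ⟨c, hc, lt_of_le_of_ne (h c hc) fun h0 => hcr ?_⟩
  rw [Multiset.mem_toFinset, mem_roots hp]
  exact h0.symm

theorem polyIntegral_comp_neg (p : ℝ[X]) : polyIntegral (p.comp (-X)) = polyIntegral p := by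
  simp only [polyIntegral_apply, eval_comp, eval_neg, eval_X]
  rw [intervalIntegral.integral_comp_neg fun x => p.eval x]
  simp

/-- Zeros of orthogonal polynomials are simple and interior, once they are known to be real. -/
theorem roots_of_orthogonal {K w : ℝ[X]} (hK : K ≠ 0) (hw : w ≠ 0)
    (hw0 : ∀ x ∈ Set.Icc (-1 : ℝ) 1, 0 ≤ w.eval x)
    (h : ∀ s : ℝ[X], s.natDegree < K.natDegree → polyIntegral (w * K * s) = 0) :
    K.roots.Nodup ∧ ∀ a ∈ K.roots, a ∈ Set.Ioo (-1 : ℝ) 1 := by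
  constructor
  · rw [Multiset.nodup_iff_count_le_one]
    intro a
    rw [count_roots]
    by_contra! hlt
    obtain ⟨q, hq⟩ := (le_rootMultiplicity_iff hK).1 (Nat.succ_le_of_lt hlt)
    have hq0 : q ≠ 0 := by rintro rfl; simp [hq] at hK
    have hX : (X - C a) ^ 2 ≠ 0 := pow_ne_zero _ (X_sub_C_ne_zero a)
    have hdeg : q.natDegree < K.natDegree := by
      rw [hq, natDegree_mul hX hq0, natDegree_pow, natDegree_X_sub_C]; omega
    -- With K = (X - a)² q, the integrand w K q = w ((X - a) q)² is nonnegative, contradicting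
    -- orthogonality to q.
    refine (polyIntegral_pos (p := w * K * q) (mul_ne_zero (mul_ne_zero hw hK) hq0) ?_).ne' (h q hdeg)
    intro x hx
    have : (w * K * q).eval x = w.eval x * ((x - a) * q.eval x) ^ 2 := by
      rw [hq]; simp; ring
    rw [this]
    exact mul_nonneg (hw0 x hx) (sq_nonneg _)
  · intro a ha
    obtain ⟨q, hq⟩ := dvd_iff_isRoot.2 ((mem_roots hK).1 ha)
    have hq0 : q ≠ 0 := by rintro rfl; simp [hq] at hK
    have hdeg : q.natDegree < K.natDegree := by
      rw [hq, natDegree_mul (X_sub_C_ne_zero a) hq0, natDegree_X_sub_C]; omega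
    have hne : w * K * q ≠ 0 := mul_ne_zero (mul_ne_zero hw hK) hq0
    have heval : ∀ x, (w * K * q).eval x = (x - a) * (w.eval x * (q.eval x) ^ 2) := by
      intro x; rw [hq]; simp; ring
    have h0 := h q hdeg
    constructor
    · by_contra! hle
      refine (polyIntegral_pos hne fun x hx => ?_).ne' h0
      rw [heval]
      exact mul_nonneg (by linarith [hx.1]) (mul_nonneg (hw0 x hx) (sq_nonneg _))
    · by_contra! hle
      refine (polyIntegral_pos (neg_ne_zero.2 hne) fun x hx => ?_).ne'
        (by rw [map_neg, h0, neg_zero])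
      rw [eval_neg, heval, ← neg_mul]
      exact mul_nonneg (by linarith [hx.2]) (mul_nonneg (hw0 x hx) (sq_nonneg _))

/-- The quadrature at the zeros of `M` gains as many degrees as `M` has orthogonality relations. -/
theorem exists_weights {M : ℝ[X]} {A : Finset ℝ} {k m : ℕ} (hM : M ≠ 0)
    (hA : M.natDegree = A.card) (hMA : ∀ a ∈ A, M.eval a = 0)
    (horth : ∀ s : ℝ[X], s.natDegree < k → polyIntegral (M * s) = 0) (hm : m < A.card + k) :
    ∃ μ : ℝ → ℝ, ∀ p : ℝ[X], p.natDegree ≤ m →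
      polyIntegral p = ∑ a ∈ A, μ a * p.eval a := by
  refine ⟨fun a => polyIntegral (Lagrange.basis A id a), fun p hp => ?_⟩
  -- Orthogonality kills the quotient part, and the remainder is recovered by Lagrange interpolation
  -- on `A`.
  have h1 : polyIntegral (M * (p / M)) = 0 := by
    by_cases h0 : p / M = 0
    · simp [h0]
    refine horth _ ?_
    have hdeg : M.degree ≤ p.degree := by
      by_contra! hlt
      exact h0 ((Polynomial.div_eq_zero_iff hM).2 hlt)
    have hp0 : p ≠ 0 := by rintro rfl; simp at h0
    have := degree_add_div hM hdeg
    rw [degree_eq_natDegree hM, degree_eq_natDegree h0, degree_eq_natDegree hp0] at this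
    have : M.natDegree + (p / M).natDegree = p.natDegree := by exact_mod_cast this
    omega
  have h2 : (p % M).degree < A.card := by
    have := degree_mod_lt p hM
    rwa [degree_eq_natDegree hM, hA] at this
  have h3 := EuclideanDomain.div_add_mod p M
  have h4 := Lagrange.eq_interpolate (v := id) (Function.injective_id.injOn (s := (A : Set ℝ))) h2
  have h5 : ∀ a ∈ A, (p % M).eval a = p.eval a := by
    intro a ha
    conv_rhs => rw [← h3]
    simp [hMA a ha]
  conv_lhs => rw [← h3, map_add, h1, zero_add, h4, Lagrange.interpolate_apply, map_sum]
  refine Finset.sum_congr rfl fun a ha => ?_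
  rw [polyIntegral_C_mul, id, h5 a ha, mul_comm]

/-! ### Real-rootedness under differentiation -/

/-- Rolle with multiplicities: differentiation loses at most one real root, and the degree drops by
one. -/
theorem splits_derivative {p : ℝ[X]} (hp : p.Splits) : (derivative p).Splits := by
  rcases Nat.eq_zero_or_pos p.natDegree with h | h
  · rw [eq_C_of_natDegree_eq_zero h, derivative_C]; exact Splits.zero
  · rw [splits_iff_card_roots] at hp ⊢
    have h1 := card_roots_le_derivative p
    have h2 := (derivative p).card_roots'
    rw [natDegree_derivative] at h2 ⊢
    omega

theorem splits_iterate_derivative {p : ℝ[X]} (hp : p.Splits) (k : ℕ) :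
    (derivative^[k] p).Splits := by
  induction k with
  | zero => exact hp
  | succ k ih => rw [Function.iterate_succ_apply']; exact splits_derivative ih

theorem natDegree_iterate_derivative_eq (p : ℝ[X]) (k : ℕ) :
    (derivative^[k] p).natDegree = p.natDegree - k := by
  induction k with
  | zero => rfl
  | succ k ih => rw [Function.iterate_succ_apply', natDegree_derivative, ih]; omega

theorem splits_X_sq_sub_one_pow (n : ℕ) : (((X : ℝ[X]) ^ 2 - 1) ^ n).Splits := by
  refine Splits.pow ?_ n
  have : (X : ℝ[X]) ^ 2 - 1 = (X - C 1) * (X - C (-1)) := by simp; ring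
  rw [this]
  exact (Splits.X_sub_C _).mul (Splits.X_sub_C _)

theorem natDegree_X_sq_sub_one_pow (n : ℕ) : (((X : ℝ[X]) ^ 2 - 1) ^ n).natDegree = 2 * n := by
  rw [natDegree_pow, show (1 : ℝ[X]) = C 1 by simp, natDegree_X_pow_sub_C, mul_comm]

/-! ### Legendre polynomials -/

theorem legendre_coeff_ne_zero (n : ℕ) : ((2 : ℝ) ^ n * (n.factorial : ℝ))⁻¹ ≠ 0 := by positivity

theorem natDegree_legendre (n : ℕ) : (legendre n).natDegree = n := by
  rw [legendre, natDegree_C_mul (legendre_coeff_ne_zero n), natDegree_iterate_derivative_eq,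
    natDegree_X_sq_sub_one_pow]
  omega

theorem legendre_zero : legendre 0 = 1 := by simp [legendre]

theorem legendre_ne_zero (n : ℕ) : legendre n ≠ 0 := by
  rcases Nat.eq_zero_or_pos n with rfl | h
  · rw [legendre_zero]; exact one_ne_zero
  · exact ne_zero_of_natDegree_gt (n := 0) (by rwa [natDegree_legendre])

theorem splits_legendre (n : ℕ) : (legendre n).Splits :=
  (splits_iterate_derivative (splits_X_sq_sub_one_pow n) n).C_mul _

theorem iterate_derivative_X_sq_sub_one_pow_succ (n k : ℕ) :
    derivative^[k + 1] (((X : ℝ[X]) ^ 2 - 1) ^ (n + 1)) =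
      C (2 * ((n : ℝ) + 1)) * derivative^[k] ((X ^ 2 - 1) ^ n * X) := by
  rw [Function.iterate_succ_apply, derivative_pow_succ, ← iterate_derivative_C_mul]
  congr 1
  simp only [derivative_sub, derivative_X_pow, derivative_one, map_mul, map_add, map_natCast,
    C_ofNat, map_one]
  push_cast
  ring

theorem legendre_coeff_succ (n : ℕ) :
    ((2 : ℝ) ^ (n + 1) * ((n + 1).factorial : ℝ))⁻¹ * (2 * ((n : ℝ) + 1)) =
      ((2 : ℝ) ^ n * (n.factorial : ℝ))⁻¹ := by
  rw [Nat.factorial_succ]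
  push_cast
  field_simp
  ring

/-- Writing P_{n+1} as an n-th derivative, like P_n, makes the recurrences instances of Leibniz'
rule for multiplication by X. -/
theorem legendre_succ (n : ℕ) :
    legendre (n + 1) = C (((2 : ℝ) ^ n * (n.factorial : ℝ))⁻¹) *
      derivative^[n] ((X ^ 2 - 1) ^ n * X) := by
  rw [legendre, iterate_derivative_X_sq_sub_one_pow_succ, ← mul_assoc, ← C_mul,
    legendre_coeff_succ]

theorem derivative_legendre_succ (n : ℕ) :
    derivative (legendre (n + 1)) =
      X * derivative (legendre n) + ((n : ℝ[X]) + 1) * legendre n := by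
  rw [legendre_succ, legendre, derivative_C_mul, derivative_C_mul, ← Function.iterate_succ_apply' (⇑derivative),
    iterate_derivative_mul_X, ← Function.iterate_succ_apply' (⇑derivative)]
  simp only [nsmul_eq_mul, Nat.succ_sub_one, Nat.cast_succ]
  ring

/-- With u = X² - 1, the derivative D^{n+1} u^{n+1} is computed in two ways: by differentiating the
power once, and by expanding u^{n+1} = X² u^n - u^n. -/
theorem legendre_succ_eq (n : ℕ) :
    ((n : ℝ[X]) + 1) * legendre (n + 1) =
      (X ^ 2 - 1) * derivative (legendre n) + ((n : ℝ[X]) + 1) * X * legendre n := by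
  have h1 := iterate_derivative_X_sq_sub_one_pow_succ n n
  have h2 : derivative^[n + 1] (((X : ℝ[X]) ^ 2 - 1) ^ (n + 1)) =
      derivative^[n + 1] ((X ^ 2 - 1) ^ n * X * X) - derivative^[n + 1] ((X ^ 2 - 1) ^ n) := by
    rw [← iterate_derivative_sub]; congr 1; ring
  rw [iterate_derivative_mul_X, iterate_derivative_mul_X, Nat.add_sub_cancel,
    iterate_derivative_mul_X] at h2
  rw [iterate_derivative_mul_X] at h1
  have h3 : derivative (legendre n) = C (((2 : ℝ) ^ n * (n.factorial : ℝ))⁻¹) *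
      derivative^[n + 1] ((X ^ 2 - 1) ^ n) := by
    rw [legendre, derivative_C_mul, ← Function.iterate_succ_apply' (⇑derivative)]
  rw [legendre_succ, iterate_derivative_mul_X, h3, legendre]
  simp only [nsmul_eq_mul, Nat.cast_succ, map_mul, map_add, map_natCast, C_ofNat, map_one]
    at h1 h2 ⊢
  have h4 := h1.symm.trans h2
  linear_combination (C (((2 : ℝ) ^ n * (n.factorial : ℝ))⁻¹)) * h4

theorem derivative_legendre (n : ℕ) :
    derivative (legendre n) =
      X * derivative (legendre (n + 1)) - ((n : ℝ[X]) + 1) * legendre (n + 1) := by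
  rw [derivative_legendre_succ, legendre_succ_eq]; ring

/-- Legendre's differential equation. -/
theorem legendre_ode (n : ℕ) :
    derivative ((X ^ 2 - 1) * derivative (legendre n)) =
      (n : ℝ[X]) * ((n : ℝ[X]) + 1) * legendre n := by
  have h : (X ^ 2 - 1) * derivative (legendre n) =
      ((n : ℝ[X]) + 1) * (legendre (n + 1) - X * legendre n) := by
    linear_combination -legendre_succ_eq n
  have hc : ((n : ℝ[X]) + 1) = C ((n : ℝ) + 1) := by simp
  rw [h, hc, derivative_C_mul, derivative_sub, derivative_mul, derivative_X,
    derivative_legendre_succ, ← hc]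
  ring

theorem eval_one_legendre (n : ℕ) : (legendre n).eval 1 = 1 := by
  induction n with
  | zero => simp [legendre_zero]
  | succ n ih =>
    have h := congrArg (eval 1) (legendre_succ_eq n)
    simp [ih] at h
    have : (n : ℝ) + 1 ≠ 0 := by positivity
    exact mul_left_cancel₀ this (by rw [h, mul_one])

theorem eval_neg_one_legendre_succ (n : ℕ) :
    (legendre (n + 1)).eval (-1) = -(legendre n).eval (-1) := by
  have h := congrArg (eval (-1)) (legendre_succ_eq n)
  simp at h
  have : (n : ℝ) + 1 ≠ 0 := by positivity
  exact mul_left_cancel₀ this (by rw [h]; ring)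

/-- The weight computations need only this square, so the sign (-1)^n never has to be tracked. -/
theorem eval_neg_one_legendre_sq (n : ℕ) : (legendre n).eval (-1) ^ 2 = 1 := by
  induction n with
  | zero => simp [legendre_zero]
  | succ n ih => rw [eval_neg_one_legendre_succ, neg_sq, ih]

theorem legendre_ode_eval (n : ℕ) (x : ℝ) :
    2 * x * (derivative (legendre n)).eval x +
        (x ^ 2 - 1) * (derivative (derivative (legendre n))).eval x =
      n * (n + 1) * (legendre n).eval x := by
  have h := congrArg (eval x) (legendre_ode n)
  simp [derivative_mul] at h
  linarith

theorem eval_one_derivative_legendre (n : ℕ) :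
    (derivative (legendre n)).eval 1 = n * (n + 1) / 2 := by
  have h := legendre_ode_eval n 1
  rw [eval_one_legendre] at h
  linarith

theorem eval_neg_one_derivative_legendre (n : ℕ) :
    (derivative (legendre n)).eval (-1) = -(n * (n + 1) / 2) * (legendre n).eval (-1) := by
  have h := legendre_ode_eval n (-1)
  linarith

theorem eval_iterate_derivative_X_sq_sub_one_pow {n k : ℕ} (h : k < n) {x : ℝ} (hx : x ^ 2 = 1) :
    (derivative^[k] (((X : ℝ[X]) ^ 2 - 1) ^ n)).eval x = 0 := by
  have h1 : ((X : ℝ[X]) ^ 2 - 1) ∣ derivative^[k] (((X : ℝ[X]) ^ 2 - 1) ^ n) :=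
    (dvd_pow_self _ (by omega)).trans (pow_sub_dvd_iterate_derivative_pow _ n k)
  refine eval_eq_zero_of_dvd_of_eval_eq_zero h1 ?_
  simp [hx]

/-- Integration by parts k times; the boundary terms vanish because ±1 are zeros of order n of (X² -
1)^n. -/
theorem polyIntegral_iterate_derivative_mul (n k : ℕ) (hk : k ≤ n) (s : ℝ[X])
    (hs : derivative^[k] s = 0) :
    polyIntegral (derivative^[k] ((X ^ 2 - 1) ^ n) * s) = 0 := by
  induction k generalizing s with
  | zero => rw [Function.iterate_zero_apply] at hs; simp [hs]
  | succ k ih =>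
    rw [Function.iterate_succ_apply', polyIntegral_derivative_mul,
      ih (by omega) _ (by rwa [Function.iterate_succ_apply] at hs),
      eval_iterate_derivative_X_sq_sub_one_pow (by omega) (by norm_num),
      eval_iterate_derivative_X_sq_sub_one_pow (by omega) (by norm_num)]
    ring

theorem polyIntegral_legendre_mul {n : ℕ} {s : ℝ[X]} (hs : s.natDegree < n) :
    polyIntegral (legendre n * s) = 0 := by
  rw [legendre, mul_assoc, polyIntegral_C_mul, polyIntegral_iterate_derivative_mul n n le_rfl s
    (iterate_derivative_eq_zero hs), mul_zero]

/-! ### Computing weights from test polynomials -/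

theorem weight_eq {A : Finset ℝ} {m : ℕ} {μ : ℝ → ℝ}
    (hμ : ∀ p : ℝ[X], p.natDegree ≤ m → polyIntegral p = ∑ a ∈ A, μ a * p.eval a)
    {a : ℝ} (ha : a ∈ A) {p : ℝ[X]} (hp : p.natDegree ≤ m)
    (h0 : ∀ b ∈ A, b ≠ a → p.eval b = 0) : μ a * p.eval a = polyIntegral p := by
  rw [hμ p hp]
  exact (Finset.sum_eq_single_of_mem (f := fun b => μ b * p.eval b) a ha fun b hb hba => by simp only [h0 b hb hba, mul_zero]).symm

/-- Division of a polynomial by the linear factor of one of its roots. -/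
theorem exists_root_quotient {K : ℝ[X]} (hK : K ≠ 0) {a : ℝ} (ha : K.eval a = 0) :
    ∃ q : ℝ[X], K = (X - C a) * q ∧ K.natDegree = q.natDegree + 1 ∧
      derivative K = q + (X - C a) * derivative q ∧
      (∀ b, K.eval b = 0 → b ≠ a → q.eval b = 0) ∧ (derivative K).eval a = q.eval a := by
  obtain ⟨q, hq⟩ := dvd_iff_isRoot.2 (show K.IsRoot a from ha)
  have hq0 : q ≠ 0 := by rintro rfl; simp [hq] at hK
  have hd : derivative K = q + (X - C a) * derivative q := by
    rw [hq, derivative_mul, derivative_X_sub_C, one_mul]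
  refine ⟨q, hq, ?_, hd, fun b hb hba => ?_, by rw [hd]; simp⟩
  · rw [hq, natDegree_mul (X_sub_C_ne_zero a) hq0, natDegree_X_sub_C, add_comm]
  · rw [hq, eval_mul, eval_sub, eval_X, eval_C] at hb
    exact (mul_eq_zero.1 hb).resolve_left (sub_ne_zero.2 hba)

theorem card_roots_toFinset {K : ℝ[X]} (hs : K.Splits) (hn : K.roots.Nodup) :
    K.roots.toFinset.card = K.natDegree := by
  rw [Multiset.toFinset_card_of_nodup hn, hs.natDegree_eq_card_roots]

/-! ### Gauss -/

theorem gauss_nodes (n : ℕ) :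
    (legendre n).roots.toFinset.card = n ∧
      ∀ a ∈ (legendre n).roots.toFinset, a ∈ Set.Ioo (-1 : ℝ) 1 := by
  obtain ⟨h1, h2⟩ := roots_of_orthogonal (K := legendre n) (w := 1) (legendre_ne_zero n)
    one_ne_zero (by simp) (fun s hs => by
      rw [natDegree_legendre] at hs
      rw [one_mul, polyIntegral_legendre_mul hs])
  refine ⟨?_, fun a ha => h2 a (Multiset.mem_toFinset.1 ha)⟩
  rw [card_roots_toFinset (splits_legendre n) h1, natDegree_legendre]

theorem gauss_exact {n : ℕ} (hn : 1 ≤ n) : IsExactOn (gauss n) (2 * n - 1) := by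
  obtain ⟨hcard, hIoo⟩ := gauss_nodes n
  have hroot : ∀ a ∈ (legendre n).roots.toFinset, (legendre n).eval a = 0 := fun a ha =>
    (mem_roots (legendre_ne_zero n)).1 (Multiset.mem_toFinset.1 ha)
  obtain ⟨μ, hμ⟩ := exists_weights (M := legendre n) (k := n) (m := 2 * n - 1)
    (legendre_ne_zero n) (by rw [hcard, natDegree_legendre]) hroot
    (fun s hs => polyIntegral_legendre_mul hs) (by omega)
  intro p hp
  rw [← polyIntegral_apply, hμ p hp, gauss]
  refine Finset.sum_congr rfl fun a ha => ?_
  congr 1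
  obtain ⟨q, hq, hdeg, hder, hq0, hqa⟩ := exists_root_quotient (legendre_ne_zero n) (hroot a ha)
  rw [natDegree_legendre] at hdeg
  -- With q = P_n / (X - a), q² isolates a. Since P_n' q = q² + P_n q' and P_n is orthogonal to q',
  -- its integral is a difference of boundary values.
  have hw := weight_eq hμ ha (p := q * q) (natDegree_mul_le.trans (by omega))
    (fun b hb hba => by rw [eval_mul, hq0 b (hroot b hb) hba, mul_zero])
  have h1 := polyIntegral_derivative_mul (legendre n) q
  rw [polyIntegral_legendre_mul (s := derivative q)
    (lt_of_le_of_lt (natDegree_derivative_le q) (by omega))] at h1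
  have h2 : polyIntegral (derivative (legendre n) * q) = polyIntegral (q * q) := by
    rw [show derivative (legendre n) * q = q * q + legendre n * derivative q by
      linear_combination q * hder - derivative q * hq, map_add, polyIntegral_legendre_mul (s := derivative q)
      (lt_of_le_of_lt (natDegree_derivative_le q) (by omega)), add_zero]
  have e1 := congrArg (eval 1) hq
  have e2 := congrArg (eval (-1)) hq
  have e3 := eval_neg_one_legendre_sq n
  have e4 := congrArg (eval a) (legendre_succ_eq n)
  simp [hroot a ha, hqa] at e1 e2 e4
  rw [eval_one_legendre] at h1 e1
  obtain ⟨ha1, ha2⟩ := hIoo a ha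
  have d1 : 1 - a ≠ 0 := by linarith
  have d2 : 1 + a ≠ 0 := by linarith
  have q1 : q.eval 1 = 1 / (1 - a) := by rw [eq_div_iff d1]; linarith
  have q2 : (legendre n).eval (-1) * q.eval (-1) = -1 / (1 + a) := by
    rw [eq_div_iff d2]; linear_combination ((legendre n).eval (-1)) * e2 - e3
  rw [← h2, h1, q2, q1, eval_mul] at hw
  have hw' : μ a * (q.eval a * q.eval a) * ((1 - a) * (1 + a)) = 2 := by
    rw [hw]; field_simp; ring
  have hne : q.eval a ≠ 0 := by
    intro h; rw [h] at hw'; norm_num at hw'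
  -- At a zero a of P_n, `legendre_succ_eq` trades P_n'(a) = q(a) for P_{n+1}(a).
  have hD : ((n : ℝ) + 1) ^ 2 * (legendre (n + 1)).eval a ^ 2 =
      ((1 - a) * (1 + a)) ^ 2 * q.eval a ^ 2 := by
    rw [← mul_pow, e4]; ring
  rw [hD, div_eq_iff (by positivity)]
  linear_combination (-(1 - a) * (1 + a)) * hw'

/-! ### Lobatto -/

theorem natDegree_derivative_legendre (n : ℕ) : (derivative (legendre n)).natDegree = n - 1 := by
  rw [natDegree_derivative, natDegree_legendre]

theorem derivative_legendre_ne_zero {n : ℕ} (hn : 1 ≤ n) : derivative (legendre n) ≠ 0 := by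
  intro h
  have h1 := eval_one_derivative_legendre n
  rw [h, eval_zero] at h1
  have : (0 : ℝ) < n := by exact_mod_cast hn
  have : (0 : ℝ) < n * (n + 1) / 2 := by positivity
  linarith

theorem polyIntegral_lobatto_mul {n : ℕ} {s : ℝ[X]} (hs : s.natDegree < n - 1) :
    polyIntegral ((X ^ 2 - 1) * derivative (legendre n) * s) = 0 := by
  have h : (X ^ 2 - 1) * derivative (legendre n) * s =
      C ((n : ℝ) + 1) * (legendre (n + 1) * s - legendre n * (X * s)) := by
    simp only [map_add, map_natCast, map_one]
    linear_combination -s * legendre_succ_eq n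
  rw [h, polyIntegral_C_mul, map_sub, polyIntegral_legendre_mul (by omega),
    polyIntegral_legendre_mul, sub_zero, mul_zero]
  refine lt_of_le_of_lt natDegree_mul_le ?_
  rw [natDegree_X]; omega

/-- P_n' is orthogonal to lower degrees for the weight 1 - X², which is nonnegative on [-1, 1]. -/
theorem lobatto_nodes {n : ℕ} (hn : 1 ≤ n) :
    (derivative (legendre n)).roots.toFinset.card = n - 1 ∧
      ∀ a ∈ (derivative (legendre n)).roots.toFinset, a ∈ Set.Ioo (-1 : ℝ) 1 := by
  have hw : (1 - X ^ 2 : ℝ[X]) ≠ 0 := by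
    intro h
    have := congrArg (eval 0) h
    simp at this
  obtain ⟨h1, h2⟩ := roots_of_orthogonal (K := derivative (legendre n)) (w := 1 - X ^ 2)
    (derivative_legendre_ne_zero hn) hw
    (fun x hx => by simp; exact abs_le.2 hx) (fun s hs => by
      rw [natDegree_derivative_legendre] at hs
      rw [show (1 - X ^ 2 : ℝ[X]) * derivative (legendre n) * s =
        -((X ^ 2 - 1) * derivative (legendre n) * s) by ring, map_neg,
        polyIntegral_lobatto_mul hs, neg_zero])
  refine ⟨?_, fun a ha => h2 a (Multiset.mem_toFinset.1 ha)⟩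
  rw [card_roots_toFinset (splits_derivative (splits_legendre n)) h1,
    natDegree_derivative_legendre]

theorem lobatto_exact {n : ℕ} (hn : 1 ≤ n) : IsExactOn (lobatto (n + 1)) (2 * n - 1) := by
  obtain ⟨hcard, hIoo⟩ := lobatto_nodes hn
  set P := legendre n with hP
  have hP'0 := derivative_legendre_ne_zero hn
  rw [← hP] at hP'0
  have hroot : ∀ a ∈ (derivative P).roots.toFinset, (derivative P).eval a = 0 := fun a ha =>
    (mem_roots hP'0).1 (Multiset.mem_toFinset.1 ha)
  have h1R : (1 : ℝ) ∉ (derivative P).roots.toFinset := fun h => (hIoo 1 h).2.false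
  have h2R : (-1 : ℝ) ∉ insert 1 (derivative P).roots.toFinset := by
    rw [Finset.mem_insert]
    rintro (h | h)
    · norm_num at h
    · exact (hIoo _ h).1.false
  have hA : (insert (-1) (insert 1 (derivative P).roots.toFinset)).card = n + 1 := by
    rw [Finset.card_insert_of_notMem h2R, Finset.card_insert_of_notMem h1R, hcard]; omega
  have hu : (X ^ 2 - 1 : ℝ[X]) ≠ 0 := by
    intro h
    have := congrArg (eval 0) h
    simp at this
  have hud : (X ^ 2 - 1 : ℝ[X]).natDegree = 2 := by
    simpa using natDegree_X_sq_sub_one_pow 1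
  have hPd : (derivative P).natDegree = n - 1 := natDegree_derivative_legendre n
  have hn0 : (n : ℝ) ≠ 0 := by positivity
  obtain ⟨μ, hμ⟩ := exists_weights (M := (X ^ 2 - 1) * derivative P) (k := n - 1)
    (A := insert (-1) (insert 1 (derivative P).roots.toFinset)) (m := 2 * n - 1)
    (mul_ne_zero hu hP'0) (by rw [hA, natDegree_mul hu hP'0, hud, hPd]; omega)
    (by
      intro a ha
      rcases Finset.mem_insert.1 ha with rfl | ha
      · simp
      rcases Finset.mem_insert.1 ha with rfl | ha
      · simp
      · simp [hroot a ha])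
    (fun s hs => polyIntegral_lobatto_mul hs) (by omega)
  have hP1 : P.eval 1 = 1 := eval_one_legendre n
  have hPm : P.eval (-1) ^ 2 = 1 := eval_neg_one_legendre_sq n
  have hP'1 : (derivative P).eval 1 = n * (n + 1) / 2 := eval_one_derivative_legendre n
  have hP'm : (derivative P).eval (-1) = -(n * (n + 1) / 2) * P.eval (-1) :=
    eval_neg_one_derivative_legendre n
  have hPint : polyIntegral P = 0 := by
    simpa using polyIntegral_legendre_mul (n := n) (s := 1) (by rw [natDegree_one]; omega)
  have w1 : μ 1 = 2 / ((n + 1) * n) := by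
    have hw := weight_eq hμ (a := 1) (p := derivative P * (X + 1)) (by simp)
      (natDegree_mul_le.trans (by rw [hPd, ← C_1, natDegree_X_add_C]; omega))
      (by
        intro b hb hb1
        rcases Finset.mem_insert.1 hb with rfl | hb
        · simp
        rcases Finset.mem_insert.1 hb with rfl | hb
        · exact absurd rfl hb1
        · simp [hroot b hb])
    rw [polyIntegral_derivative_mul] at hw
    simp [hP1, hP'1, hPint] at hw
    rw [eq_div_iff (by positivity)]
    linear_combination hw
  have w2 : μ (-1) = 2 / ((n + 1) * n) := by
    have hw := weight_eq hμ (a := -1) (p := derivative P * (X - 1)) (by simp)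
      (natDegree_mul_le.trans (by rw [hPd, ← C_1, natDegree_X_sub_C]; omega))
      (by
        intro b hb hb1
        rcases Finset.mem_insert.1 hb with rfl | hb
        · exact absurd rfl hb1
        rcases Finset.mem_insert.1 hb with rfl | hb
        · simp
        · simp [hroot b hb])
    rw [polyIntegral_derivative_mul] at hw
    simp [hP1, hP'm, hPint] at hw
    rw [eq_div_iff (by positivity)]
    linear_combination (-P.eval (-1)) * hw - (μ (-1) * n * (n + 1) - 2) * hPm
  intro p hp
  rw [← polyIntegral_apply, hμ p hp, lobatto, Finset.sum_insert h2R, Finset.sum_insert h1R, w1, w2]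
  simp only [Nat.add_sub_cancel, Nat.cast_add, Nat.cast_one, add_sub_cancel_right, ← hP]
  rw [← add_assoc]
  congr 1
  refine Finset.sum_congr rfl fun a ha => ?_
  congr 1
  obtain ⟨r, hr, hdeg, hder, hr0, hra⟩ := exists_root_quotient hP'0 (hroot a ha)
  rw [hPd] at hdeg
  have hr' : (derivative r).natDegree < n - 1 :=
    lt_of_le_of_lt (natDegree_derivative_le r) (by omega)
  have hw := weight_eq hμ (a := a) (p := (X ^ 2 - 1) * r * r) (by simp [ha])
    (natDegree_mul_le.trans (by
      have := natDegree_mul_le (p := (X ^ 2 - 1 : ℝ[X])) (q := r)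
      omega))
    (by
      intro b hb hb1
      rcases Finset.mem_insert.1 hb with rfl | hb
      · simp
      rcases Finset.mem_insert.1 hb with rfl | hb
      · simp
      · simp [hr0 b (hroot b hb) hb1])
  have i1 := polyIntegral_lobatto_mul hr'
  rw [← hP] at i1
  have i2 : polyIntegral (P * r) = 0 := polyIntegral_legendre_mul (n := n) (by omega)
  have i3 : polyIntegral (P * derivative (X * r)) = 0 := polyIntegral_legendre_mul (n := n)
    (lt_of_le_of_lt (natDegree_derivative_le _) (by
      have := natDegree_mul_le (p := (X : ℝ[X])) (q := r)
      rw [natDegree_X] at this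
      omega))
  have i4 := polyIntegral_derivative_mul P (X * r)
  rw [i3] at i4
  have hode : 2 * X * derivative P + (X ^ 2 - 1) * derivative (derivative P) =
      (n : ℝ[X]) * ((n : ℝ[X]) + 1) * P := by
    have hdu : derivative (X ^ 2 - 1 : ℝ[X]) = 2 * X := by simp; norm_num
    rw [hP, ← legendre_ode n, derivative_mul, hdu]
  -- From P'' r = r² + P' r' and Legendre's equation. The terms in P r and (X² - 1) P' r' integrate
  -- to zero, and X P' r contributes only boundary values.
  have i5 : (X ^ 2 - 1) * r * r = C ((n : ℝ) * (n + 1)) * (P * r) -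
      C 2 * (derivative P * (X * r)) - (X ^ 2 - 1) * derivative P * derivative r := by
    simp only [map_add, map_natCast, map_one, map_mul, C_ofNat]
    linear_combination r * hode - (X ^ 2 - 1) * r * hder + (X ^ 2 - 1) * derivative r * hr
  rw [i5, map_sub, map_sub, polyIntegral_C_mul, polyIntegral_C_mul, i1, i2, i4, ← i5] at hw
  have e1 := congrArg (eval 1) hr
  have e2 := congrArg (eval (-1)) hr
  have e3 := congrArg (eval a) hode
  simp [hroot a ha, hP'1, hP'm, hra] at e1 e2 e3
  simp [hP1] at hw
  obtain ⟨ha1, ha2⟩ := hIoo a ha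
  have d1 : 1 - a ≠ 0 := by linarith
  have d2 : 1 + a ≠ 0 := by linarith
  have q1 : r.eval 1 = n * (n + 1) / 2 / (1 - a) := by rw [eq_div_iff d1]; linarith
  have q2 : P.eval (-1) * r.eval (-1) = n * (n + 1) / 2 / (1 + a) := by
    rw [eq_div_iff d2]
    linear_combination (P.eval (-1)) * e2 + (n * (n + 1) / 2 : ℝ) * hPm
  rw [q2, q1] at hw
  -- Legendre's equation at a reads (a² - 1) r(a) = n(n + 1) P(a), which removes r(a).
  have hw' : μ a * ((n * (n + 1)) ^ 2 * P.eval a ^ 2) = 2 * (n * (n + 1)) := by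
    have : μ a * ((a ^ 2 - 1) * r.eval a * r.eval a) * (a ^ 2 - 1) = 2 * (n * (n + 1)) := by
      rw [hw]; field_simp; ring
    rw [← this, ← mul_pow, ← e3]; ring
  have hne : P.eval a ≠ 0 := by
    intro h
    rw [h] at hw'
    have : (n : ℝ) * (n + 1) ≠ 0 := by positivity
    apply this
    linarith
  have h0 : (n : ℝ) * (n + 1) ≠ 0 := by positivity
  rw [div_eq_iff (by positivity)]
  refine mul_left_cancel₀ h0 ?_
  linear_combination -hw'

/-! ### Radau -/

/-- The nodal polynomial of the interior nodes of the left Radau quadrature with `n + 1` nodes. -/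
def radauPoly (n : ℕ) : ℝ[X] := (legendre n + legendre (n + 1)) / (X + 1)

theorem X_add_one_mul_radauPoly (n : ℕ) :
    (X + 1) * radauPoly n = legendre n + legendre (n + 1) := by
  have h : (X + 1 : ℝ[X]) ∣ legendre n + legendre (n + 1) := by
    rw [show (X + 1 : ℝ[X]) = X - C (-1) by simp, dvd_iff_isRoot, IsRoot, eval_add,
      eval_neg_one_legendre_succ, add_neg_cancel]
  refine EuclideanDomain.mul_div_cancel' (monic_X_add_C (1 : ℝ)).ne_zero h

theorem natDegree_legendre_add (n : ℕ) : (legendre n + legendre (n + 1)).natDegree = n + 1 := by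
  rw [natDegree_add_eq_right_of_natDegree_lt, natDegree_legendre]
  rw [natDegree_legendre, natDegree_legendre]; exact Nat.lt_succ_self n

theorem legendre_add_ne_zero (n : ℕ) : legendre n + legendre (n + 1) ≠ 0 :=
  ne_zero_of_natDegree_gt (n := 0) (by rw [natDegree_legendre_add]; exact Nat.succ_pos n)

theorem radauPoly_ne_zero (n : ℕ) : radauPoly n ≠ 0 := by
  intro h
  apply legendre_add_ne_zero n
  rw [← X_add_one_mul_radauPoly, h, mul_zero]

theorem natDegree_radauPoly (n : ℕ) : (radauPoly n).natDegree = n := by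
  have h := natDegree_legendre_add n
  rw [← X_add_one_mul_radauPoly, ← C_1,
    natDegree_mul (monic_X_add_C (1 : ℝ)).ne_zero (radauPoly_ne_zero n), natDegree_X_add_C] at h
  omega

/-- The sum is a multiple of the n-th derivative of (X² - 1)^n (X + 1), so Rolle applies again. -/
theorem splits_legendre_add (n : ℕ) : (legendre n + legendre (n + 1)).Splits := by
  have h : legendre n + legendre (n + 1) = C (((2 : ℝ) ^ n * (n.factorial : ℝ))⁻¹) *
      derivative^[n] ((X ^ 2 - 1) ^ n * (X - C (-1))) := by
    rw [legendre_succ, legendre, ← mul_add, ← iterate_map_add]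
    congr 2
    simp only [map_neg, map_one]
    ring
  rw [h]
  exact (splits_iterate_derivative
    ((splits_X_sq_sub_one_pow n).mul (Splits.X_sub_C _)) n).C_mul _

theorem splits_radauPoly (n : ℕ) : (radauPoly n).Splits :=
  (splits_legendre_add n).of_dvd (legendre_add_ne_zero n)
    (Dvd.intro_left _ (X_add_one_mul_radauPoly n))

theorem polyIntegral_radau_mul {n : ℕ} {s : ℝ[X]} (hs : s.natDegree < n) :
    polyIntegral ((legendre n + legendre (n + 1)) * s) = 0 := by
  rw [add_mul, map_add, polyIntegral_legendre_mul hs, polyIntegral_legendre_mul (by omega),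
    add_zero]

theorem radau_nodes (n : ℕ) :
    (radauPoly n).roots.toFinset.card = n ∧
      ∀ a ∈ (radauPoly n).roots.toFinset, a ∈ Set.Ioo (-1 : ℝ) 1 := by
  obtain ⟨h1, h2⟩ := roots_of_orthogonal (K := radauPoly n) (w := X + 1) (radauPoly_ne_zero n)
    (by simpa using (monic_X_add_C (1 : ℝ)).ne_zero)
    (fun x hx => by simp; linarith [hx.1]) (fun s hs => by
      rw [natDegree_radauPoly] at hs
      rw [X_add_one_mul_radauPoly, polyIntegral_radau_mul hs])
  refine ⟨?_, fun a ha => h2 a (Multiset.mem_toFinset.1 ha)⟩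
  rw [card_roots_toFinset (splits_radauPoly n) h1, natDegree_radauPoly]

/-- At an interior Radau node both Legendre polynomials have the same derivative. -/
theorem derivative_legendre_add_eval {n : ℕ} {a : ℝ} (ha : -1 < a)
    (h : (legendre n).eval a + (legendre (n + 1)).eval a = 0) :
    (derivative (legendre n)).eval a + (derivative (legendre (n + 1))).eval a =
      2 * (derivative (legendre n)).eval a := by
  have h1 := congrArg (eval a) (derivative_legendre_succ n)
  have h2 := congrArg (eval a) (derivative_legendre n)
  simp at h1 h2
  have h3 : a + 1 ≠ 0 := by linarith
  have h5 : (a + 1) * ((derivative (legendre (n + 1))).eval a -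
      (derivative (legendre n)).eval a) = 0 := by
    linear_combination h1 - h2 + ((n : ℝ) + 1) * h
  have := (mul_eq_zero.1 h5).resolve_left h3
  linarith

theorem radauLeft_exact {n : ℕ} (hn : 1 ≤ n) : IsExactOn (radauLeft (n + 1)) (2 * n) := by
  obtain ⟨hcard, hIoo⟩ := radau_nodes n
  set M := legendre n + legendre (n + 1) with hM
  set Q := radauPoly n with hQ
  have hMQ : (X + 1) * Q = M := X_add_one_mul_radauPoly n
  have hQd : Q.natDegree = n := natDegree_radauPoly n
  have hroot : ∀ a ∈ Q.roots.toFinset, Q.eval a = 0 := fun a ha =>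
    (mem_roots (radauPoly_ne_zero n)).1 (Multiset.mem_toFinset.1 ha)
  have h1R : (-1 : ℝ) ∉ Q.roots.toFinset := fun h => (hIoo _ h).1.false
  have hA : (insert (-1) Q.roots.toFinset).card = n + 1 := by
    rw [Finset.card_insert_of_notMem h1R, hcard]
  have horth : ∀ s : ℝ[X], s.natDegree < n → polyIntegral (M * s) = 0 := fun s hs =>
    polyIntegral_radau_mul hs
  obtain ⟨μ, hμ⟩ := exists_weights (M := M) (k := n) (A := insert (-1) Q.roots.toFinset)
    (m := 2 * n) (legendre_add_ne_zero n) (by rw [hA]; exact natDegree_legendre_add n)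
    (by
      intro a ha
      rcases Finset.mem_insert.1 ha with rfl | ha
      · simp [← hMQ]
      · simp [← hMQ, hroot a ha])
    horth (by omega)
  have hM1 : M.eval 1 = 2 := by
    rw [hM, eval_add, eval_one_legendre, eval_one_legendre]; norm_num
  have hMm : M.eval (-1) = 0 := by simp [← hMQ]
  have hM' : derivative M = Q + (X + 1) * derivative Q := by
    rw [← hMQ, derivative_mul]; simp
  have hQ1 : Q.eval 1 = 1 := by
    have := congrArg (eval 1) hMQ
    rw [hM1] at this
    simp at this
    linarith
  have hQm : Q.eval (-1) ^ 2 = ((n : ℝ) + 1) ^ 2 := by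
    have h1 := congrArg (eval (-1)) hM'
    rw [hM, derivative_add, eval_add, eval_neg_one_derivative_legendre,
      eval_neg_one_derivative_legendre, eval_neg_one_legendre_succ] at h1
    simp at h1
    have h2 : Q.eval (-1) = (n + 1) * (legendre n).eval (-1) := by
      rw [← h1]; ring
    rw [h2, mul_pow, eval_neg_one_legendre_sq, mul_one]
  have w1 : μ (-1) = 2 / ((n : ℝ) + 1) ^ 2 := by
    have hw := weight_eq hμ (a := -1) (p := Q * Q) (by simp) (natDegree_mul_le.trans (by omega))
      (by
        intro b hb hb1
        rcases Finset.mem_insert.1 hb with rfl | hb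
        · exact absurd rfl hb1
        · simp [hroot b hb])
    have h0 := horth (derivative Q) (lt_of_le_of_lt (natDegree_derivative_le Q) (by omega))
    have h1 := polyIntegral_derivative_mul M Q
    rw [h0, hM1, hMm, hQ1, show derivative M * Q = Q * Q + M * derivative Q by
      rw [hM', ← hMQ]; ring, map_add, h0, ← hw, eval_mul, ← sq, hQm] at h1
    rw [eq_div_iff (by positivity)]
    linarith
  intro p hp
  rw [← polyIntegral_apply, hμ p hp, radauLeft, Finset.sum_insert h1R, w1]
  simp only [Nat.add_sub_cancel, Nat.cast_add, Nat.cast_one]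
  congr 1
  refine Finset.sum_congr rfl fun a ha => ?_
  congr 1
  obtain ⟨r, hr, hdeg, hder, hr0, hra⟩ :=
    exists_root_quotient (radauPoly_ne_zero n) (hroot a ha)
  rw [← hQ] at hr hdeg hder hra
  obtain ⟨ha1, ha2⟩ := hIoo a ha
  have d1 : 1 - a ≠ 0 := by linarith
  have d2 : 1 + a ≠ 0 := by linarith
  have hr' := horth (derivative r) (lt_of_le_of_lt (natDegree_derivative_le r) (by omega))
  have hX1 : (X + 1 : ℝ[X]).natDegree = 1 := by rw [← C_1, natDegree_X_add_C]
  have hw := weight_eq hμ (a := a) (p := (X + 1) * r * r) (by simp [ha])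
    (natDegree_mul_le.trans (by
      have := natDegree_mul_le (p := (X + 1 : ℝ[X])) (q := r)
      omega))
    (by
      intro b hb hb1
      rcases Finset.mem_insert.1 hb with rfl | hb
      · simp
      · simp [hr0 b (hroot b hb) hb1])
  -- Integrating M' r by parts produces, besides (X + 1) r², the term r Q. It vanishes at every node
  -- but -1, so the weight `w1` supplies its integral.
  have hv := weight_eq hμ (a := -1) (p := r * Q) (by simp) (natDegree_mul_le.trans (by omega))
    (by
      intro b hb hb1
      rcases Finset.mem_insert.1 hb with rfl | hb
      · exact absurd rfl hb1
      · simp [hroot b hb])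
  have i1 := polyIntegral_derivative_mul M r
  have i2 : derivative M * r = r * Q + (X + 1) * r * r + M * derivative r := by
    rw [hM', ← hMQ]
    linear_combination (X + 1) * r * hder - (X + 1) * derivative r * hr
  rw [i2, map_add, map_add, hr', ← hw, ← hv, hM1, hMm, w1] at i1
  have e1 := congrArg (eval 1) hr
  have e2 := congrArg (eval (-1)) hr
  have e3 := congrArg (eval a) hM'
  rw [hQ1] at e1
  simp [hroot a ha, hra] at e1 e2 e3 i1
  have hz : (legendre n).eval a + (legendre (n + 1)).eval a = 0 := by
    rw [← eval_add, ← hM, ← hMQ, eval_mul, hroot a ha, mul_zero]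
  rw [hM, derivative_add, eval_add, derivative_legendre_add_eval ha1 hz] at e3
  have q1 : r.eval 1 = 1 / (1 - a) := by rw [eq_div_iff d1]; linarith
  have q2 : r.eval (-1) * Q.eval (-1) = -(n + 1) ^ 2 / (1 + a) := by
    rw [eq_div_iff d2, ← hQm]; linear_combination (Q.eval (-1)) * e2
  rw [q1, q2] at i1
  have hw' : μ a * ((1 - a) * ((a + 1) * r.eval a) ^ 2) = 4 := by
    have : μ a * ((a + 1) * r.eval a * r.eval a) = 4 / ((1 - a) * (1 + a)) := by
      rw [← sub_eq_zero, ← sub_eq_zero.2 i1]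
      field_simp
      ring
    rw [eq_div_iff (by positivity)] at this
    linear_combination this
  rw [← e3] at hw'
  have hne : (derivative (legendre n)).eval a ≠ 0 := by
    intro h; rw [h] at hw'; norm_num at hw'
  rw [div_eq_iff (by positivity)]
  linear_combination (-1 / 4) * hw'

theorem radauRight_exact {n : ℕ} (hn : 1 ≤ n) : IsExactOn (radauRight (n + 1)) (2 * n) := by
  intro p hp
  have h := radauLeft_exact hn (p.comp (-X)) (by
    refine natDegree_comp_le.trans ?_
    rw [natDegree_neg, natDegree_X, mul_one]
    exact hp)
  rw [← polyIntegral_apply, polyIntegral_comp_neg, polyIntegral_apply] at h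
  rw [radauRight, ← h]
  simp

end ApproxIntegration

end

/-! ### The four inequalities -/

open ApproxIntegration

theorem mainTheorem3 (n N : ℕ) (hn : 1 ≤ n) (ξ c : Fin N → ℝ)
    (hξ : ∀ i, ξ i ∈ Set.Icc (-1 : ℝ) 1) (hc : ∀ i, 0 ≤ c i) :
    (ApproxIntegration.IsExactOn (ApproxIntegration.quadrature c ξ) (2 * n - 1) →
      ∀ f : ℝ → ℝ, ApproxIntegration.HigherConvexOn (2 * n - 1) (Set.Icc (-1) 1) f →
        ApproxIntegration.gauss n f ≤ ApproxIntegration.quadrature c ξ f ∧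
        ApproxIntegration.quadrature c ξ f ≤ ApproxIntegration.lobatto (n + 1) f) ∧
    (ApproxIntegration.IsExactOn (ApproxIntegration.quadrature c ξ) (2 * n) →
      ∀ f : ℝ → ℝ, ApproxIntegration.HigherConvexOn (2 * n) (Set.Icc (-1) 1) f →
        ApproxIntegration.radauLeft (n + 1) f ≤ ApproxIntegration.quadrature c ξ f ∧
        ApproxIntegration.quadrature c ξ f ≤ ApproxIntegration.radauRight (n + 1) f) := by
  refine ⟨fun hT f hf => ⟨?_, ?_⟩, fun hT f hf => ⟨?_, ?_⟩⟩
  · obtain ⟨hcard, hIoo⟩ := gauss_nodes n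
    -- In each case `E` collects the endpoint nodes and `σ` is the sign of ∏_{e ∈ E} (x - e) on [-1,
    -- 1]; for Gauss the product is empty.
    have h := quadrature_comparison hξ hc hT hf (E := ∅) (σ := 1) (Finset.disjoint_empty_left _)
      (by simp) hIoo (by rw [hcard, Finset.card_empty]; omega) (gauss_exact hn)
      (fun f g hfg => Finset.sum_congr rfl fun a ha => by rw [hfg a (by simpa using ha)])
      (by simp) (by simp)
    linarith
  · obtain ⟨hcard, hIoo⟩ := lobatto_nodes hn
    have h := quadrature_comparison hξ hc hT hf (E := {-1, 1}) (σ := -1)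
      (by
        rw [Finset.disjoint_left]
        intro e he he'
        have := hIoo e he'
        rcases Finset.mem_insert.1 he with rfl | he
        · exact this.1.false
        · rw [Finset.mem_singleton.1 he] at this
          exact this.2.false)
      (by simp) hIoo
      (by rw [hcard, Finset.card_pair (by norm_num)]; omega) (lobatto_exact hn)
      (fun f g hfg => by
        unfold lobatto
        rw [hfg 1 (by simp), hfg (-1) (by simp)]
        congr 1
        refine Finset.sum_congr rfl fun a ha => ?_
        rw [hfg a (Finset.mem_union_right _ ha)])
      (fun x hx => by
        rw [Finset.prod_pair (by norm_num)]
        nlinarith [mul_nonneg (sub_nonneg.2 hx.1) (sub_nonneg.2 hx.2)])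
      (fun x _ hx => Finset.prod_ne_zero_iff.2 fun e he h => hx (by rwa [sub_eq_zero.1 h]))
    linarith
  · obtain ⟨hcard, hIoo⟩ := radau_nodes n
    have h := quadrature_comparison hξ hc hT hf (E := {-1}) (σ := 1)
      (by
        rw [Finset.disjoint_singleton_left]
        exact fun h => (hIoo _ h).1.false)
      (by simp) hIoo
      (by rw [hcard, Finset.card_singleton]; omega) (radauLeft_exact hn)
      (fun f g hfg => by
        unfold radauLeft
        rw [hfg (-1) (by simp)]
        congr 1
        refine Finset.sum_congr rfl fun a ha => ?_
        rw [hfg a (Finset.mem_union_right _ ha)])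
      (fun x hx => by rw [Finset.prod_singleton]; linarith [hx.1])
      (fun x _ hx => Finset.prod_ne_zero_iff.2 fun e he h => hx (by rwa [sub_eq_zero.1 h]))
    linarith
  · obtain ⟨hcard, hIoo⟩ := radau_nodes n
    have hIoo' : ∀ a ∈ (radauPoly n).roots.toFinset.image (fun x => -x),
        a ∈ Set.Ioo (-1 : ℝ) 1 := by
      intro a ha
      obtain ⟨b, hb, rfl⟩ := Finset.mem_image.1 ha
      have := hIoo b hb
      exact ⟨by linarith [this.2], by linarith [this.1]⟩
    have h := quadrature_comparison hξ hc hT hf (E := {1}) (σ := -1)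
      (by
        rw [Finset.disjoint_singleton_left]
        exact fun h => (hIoo' _ h).2.false)
      (by simp) hIoo'
      (by
        rw [Finset.card_image_of_injective _ neg_injective, hcard, Finset.card_singleton]; omega)
      (radauRight_exact hn)
      (fun f g hfg => by
        simp only [radauRight, radauLeft]
        rw [neg_neg, hfg 1 (by simp)]
        congr 1
        refine Finset.sum_congr rfl fun a ha => ?_
        rw [hfg (-a) (Finset.mem_union_right _ (Finset.mem_image_of_mem _ ha))])
      (fun x hx => by rw [Finset.prod_singleton]; linarith [hx.2])
      (fun x _ hx => Finset.prod_ne_zero_iff.2 fun e he h => hx (by rwa [sub_eq_zero.1 h]))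
    linarith
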